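/- An interval exchange transformation (IET) of $[0,1)$ is a map $T:[0,1)\to[0,1)$ for which there are an integer $d\ge 1$, numbers $p_1,\dots,p_d\ge 0$ with $\sum_{i} p_i=1$ and a permutation $\pi$ of $\{1,\dots,d\}$ such that, for every $j$ and every $x\in\big[\sum_{t<j}p_t,\ \sum_{t\le j}p_t\big)$, $$T(x)=x-\sum_{t<j}p_t+\sum_{\pi(t')<\pi(j)}p_{t'} .$$ Let $\lambda$ be Lebesgue measure on $[0,1)$, let $R_\alpha(x)=x+\alpha-\lfloor x+\alpha\rfloor$ for $\alpha,x\in[0,1)$, and let $B(x,r)=\{y\in[0,1): |y-x|<r\}$. Let $T$ be an IET of $[0,1)$ that is ergodic with respect to $\lambda$ (every measurable set $A$ with $T^{-1}A=A$ has measure $0$ or $1$), and let $(b_i)_{i\ge 1}$ be a decreasing (that is, non-increasing) sequence of positive real numbers with $\sum_{i\ge 1} b_i=\infty$. Then for almost every $x\in[0,1)$ and almost every $\alpha\in[0,1)$ (that is, for almost every $(x,\alpha)\in[0,1)^2$ with respect to two-dimensional Lebesgue measure), $$\lambda\Big(\bigcap_{n=1}^{\infty}\ \bigcup_{i=n}^{\infty}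 T^{-i}\big(B(R_\alpha^i x,\,b_i)\big)\Big)=1 .$$ -/

import Mathlib

open MeasureTheory

/-- The unit interval `[0,1)`, as a subtype of `ℝ`, with the metric `|x - y|`. -/
abbrev UnitIco : Type := Set.Ico (0 : ℝ) 1

/-- Lebesgue measure on `[0,1)`. -/
noncomputable def lam : Measure UnitIco := Measure.comap Subtype.val volume

/-- `T : [0,1) → [0,1)` is the interval exchange transformation with length vector `p` in the
simplex and permutation `π`: on the `j`-th interval
`I_j = [∑_{t<j} p_t, ∑_{t<j} p_t + p_j)` it is
`T x = x - ∑_{t<j} p_t + ∑_{π t' < π j} p_{t'}`.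
(The intervals `I_j` partition `[0,1)`, so this determines `T`.) -/
def IsIETWith {d : ℕ} (p : Fin d → ℝ) (π : Equiv.Perm (Fin d)) (T : UnitIco → UnitIco) : Prop :=
  p ∈ stdSimplex ℝ (Fin d) ∧
    ∀ (j : Fin d) (x : UnitIco),
      (x : ℝ) ∈ Set.Ico (∑ t with t < j, p t) ((∑ t with t < j, p t) + p j) →
        (T x : ℝ) = (x : ℝ) - (∑ t with t < j, p t) + ∑ t with π t < π j, p t

/-- `T` is an interval exchange transformation of `[0,1)`, on any number of intervals. -/
def IsIET (T : UnitIco → UnitIco) : Prop :=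
  ∃ (d : ℕ) (p : Fin d → ℝ) (π : Equiv.Perm (Fin d)), IsIETWith p π T

/-- The rotation `R_α x = x + α - ⌊x + α⌋` of `[0,1)`. -/
noncomputable def rot (α x : UnitIco) : UnitIco :=
  ⟨(x : ℝ) + α - ⌊(x : ℝ) + α⌋, Int.fract_nonneg _, Int.fract_lt_one _⟩

/-- The set `⋂_{n ≥ 1} ⋃_{i ≥ n} T^{-i}(B(R_α^i x, b_i))`. -/
def targetSet (T : UnitIco → UnitIco) (b : ℕ → ℝ) (x α : UnitIco) : Set UnitIco :=
  ⋂ n ≥ 1, ⋃ i ≥ n, T^[i] ⁻¹' Metric.ball ((rot α)^[i] x) (b i)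

open ProbabilityTheory Filter

/-! Fix `y`. By Fubini it suffices that for almost every `(x, α)` the point `R_α^i x` lies within `b
i` of `T^i y` infinitely often. On the torus, `(x, α) ↦ (x + iα, x + jα)` preserves Haar measure for
`i ≠ j`, so these events are pairwise independent, whatever the centres. Their probabilities are at
least `min (b i) (1/2)`, hence have divergent sum, and a Chebyshev form of Borel–Cantelli applies.
-/

/-- The second Borel–Cantelli lemma for pairwise independent events. -/
theorem ae_frequently_mem_of_pairwise_indepSet {Ω : Type*} [MeasurableSpace Ω] (μ : Measure Ω)
    [IsProbabilityMeasure μ] {A : ℕ → Set Ω} (hA : ∀ i, MeasurableSet (A i))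
    (hind : Pairwise fun i j => IndepSet (A i) (A j) μ)
    (hsum : ¬ Summable fun i => μ.real (A i)) :
    ∀ᵐ ω ∂μ, ∃ᶠ i in atTop, ω ∈ A i := by
  set X : ℕ → Ω → ℝ := fun i => (A i).indicator 1 with hX
  have hX_nonneg : ∀ i ω, 0 ≤ X i ω := fun i ω => Set.indicator_nonneg (by simp) ω
  have hX_le : ∀ i ω, X i ω ≤ 1 := fun i ω => by
    by_cases h : ω ∈ A i <;> simp [hX, h]
  have hXm : ∀ i, Measurable (X i) := fun i => measurable_one.indicator (hA i)
  have hXL : ∀ i, MemLp (X i) 2 μ := fun i =>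
    MemLp.of_bound (hXm i).aestronglyMeasurable 1 (ae_of_all _ fun ω => by
      rw [Real.norm_of_nonneg (hX_nonneg i ω)]; exact hX_le i ω)
  have hXint : ∀ i, ∫ ω, X i ω ∂μ = μ.real (A i) := fun i => integral_indicator_one (hA i)
  have hXind : ∀ i j, i ≠ j → X i ⟂ᵢ[μ] X j := by
    intro i j hij
    have h : IndepSet (A i) (A j) μ := hind hij
    rw [IndepSet_iff_Indep] at h
    refine (IndepFun_iff_Indep _ _ _).2 (indep_of_indep_of_le_left
      (indep_of_indep_of_le_right h ?_) ?_)
    all_goals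
      refine Measurable.comap_le ?_
      refine Measurable.indicator (measurable_const) ?_
      exact MeasurableSpace.measurableSet_generateFrom rfl
  set S : ℕ → Ω → ℝ := fun n => ∑ i ∈ Finset.range n, X i with hS
  set m : ℕ → ℝ := fun n => ∑ i ∈ Finset.range n, μ.real (A i) with hm
  have hSL : ∀ n, MemLp (S n) 2 μ := fun n => memLp_finsetSum' _ fun i _ => hXL i
  have hSint : ∀ n, ∫ ω, S n ω ∂μ = m n := by
    intro n
    simp only [hS, Finset.sum_apply]
    rw [integral_finsetSum _ fun i _ => (hXL i).integrable (by norm_num)]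
    simp only [hXint, hm]
  -- Pairwise independence makes variances add; an indicator equals its square, so its variance is
  -- at most its mean.
  have hvar : ∀ n, variance (S n) μ ≤ m n := by
    intro n
    rw [hS, IndepFun.variance_sum (fun i _ => hXL i) fun i _ j _ hij => hXind i j hij]
    refine Finset.sum_le_sum fun i _ => ?_
    refine (variance_le_expectation_sq (hXm i).aestronglyMeasurable).trans ?_
    rw [← hXint i]
    refine le_of_eq (integral_congr_ae (ae_of_all _ fun ω => ?_))
    by_cases h : ω ∈ A i <;> simp [hX, h]
  have hm_top : Tendsto m atTop atTop :=
    (not_summable_iff_tendsto_nat_atTop_of_nonneg fun i => measureReal_nonneg).1 hsum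
  have hnull : ∀ K : ℕ, μ {ω | ∀ n, S n ω ≤ K} = 0 := by
    intro K
    -- Once `m n ≥ 2K`, a count of at most `K` deviates from its mean by at least `m n / 2`;
    -- Chebyshev applies.
    have hbound : ∀ᶠ n in atTop, μ {ω | ∀ n, S n ω ≤ K} ≤ ENNReal.ofReal (4 / m n) := by
      filter_upwards [hm_top.eventually_ge_atTop (2 * K), hm_top.eventually_gt_atTop 0]
        with n hn hn0
      calc μ {ω | ∀ n, S n ω ≤ K} ≤ μ {ω | m n / 2 ≤ |S n ω - ∫ ω', S n ω' ∂μ|} := by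
            refine measure_mono fun ω hω => ?_
            have h := hω n
            simp only [Set.mem_ofPred_eq, hSint]
            rw [abs_sub_comm]
            exact le_trans (by linarith) (le_abs_self _)
        _ ≤ ENNReal.ofReal (variance (S n) μ / (m n / 2) ^ 2) :=
            meas_ge_le_variance_div_sq (hSL n) (by positivity)
        _ ≤ ENNReal.ofReal (4 / m n) := by
            refine ENNReal.ofReal_le_ofReal ?_
            rw [div_le_div_iff₀ (by positivity) hn0]
            nlinarith [hvar n]
    have hlim : Tendsto (fun n => ENNReal.ofReal (4 / m n)) atTop (nhds 0) := by
      rw [← ENNReal.ofReal_zero]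
      exact ENNReal.tendsto_ofReal (hm_top.const_div_atTop 4)
    exact le_antisymm (ge_of_tendsto hlim hbound) bot_le
  refine measure_mono_null (t := ⋃ K : ℕ, {ω | ∀ n, S n ω ≤ K}) (fun ω hω => ?_)
    (measure_iUnion_null hnull)
  rw [Set.mem_compl_iff, Set.mem_ofPred_eq, not_frequently, eventually_atTop] at hω
  obtain ⟨N, hN⟩ := hω
  refine Set.mem_iUnion.2 ⟨N, fun n => ?_⟩
  simp only [hS, Finset.sum_apply]
  calc ∑ i ∈ Finset.range n, X i ω ≤ ∑ i ∈ Finset.range n, if i < N then (1 : ℝ) else 0 := by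
        refine Finset.sum_le_sum fun i _ => ?_
        split_ifs with h
        · exact hX_le i ω
        · simp [hX, hN i (not_lt.1 h)]
    _ ≤ N := by
        rw [Finset.sum_boole]
        norm_cast
        calc _ ≤ (Finset.range N).card := Finset.card_le_card fun i hi => by simp_all
          _ = N := Finset.card_range N

instance : IsProbabilityMeasure lam := by
  refine ⟨?_⟩
  rw [lam, (MeasurableEmbedding.subtype_coe measurableSet_Ico).comap_apply, Set.image_univ,
    Subtype.range_coe]
  simp

/-- The projection of `[0,1)` to the circle `ℝ / ℤ`. -/
noncomputable def toCircle (x : UnitIco) : UnitAddCircle := ((x : ℝ) : UnitAddCircle)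

/-- The representative in `[0,1)` of a point of the circle. -/
noncomputable def ofCircle (u : UnitAddCircle) : UnitIco :=
  ⟨AddCircle.measurableEquivIco 1 0 u, by
    simpa only [zero_add] using (AddCircle.measurableEquivIco 1 0 u).2⟩

theorem measurable_ofCircle : Measurable ofCircle :=
  (measurable_subtype_coe.comp (AddCircle.measurableEquivIco 1 0).measurable).subtype_mk

theorem ofCircle_toCircle (x : UnitIco) : ofCircle (toCircle x) = x :=
  Subtype.ext (AddCircle.equivIco_coe_of_mem (p := (1 : ℝ)) (a := 0) (by simp))

theorem measurePreserving_toCircle : MeasurePreserving toCircle lam volume := by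
  have h := UnitAddCircle.measurePreserving_mk 0
  rw [← restrict_Ico_eq_restrict_Ioc, zero_add] at h
  have h' : MeasurePreserving (Subtype.val : UnitIco → ℝ) lam
      (volume.restrict (Set.Ico (0 : ℝ) 1)) :=
    measurePreserving_subtype_coe measurableSet_Ico
  exact h.comp h'

theorem measurePreserving_ofCircle : MeasurePreserving ofCircle volume lam := by
  refine ⟨measurable_ofCircle, ?_⟩
  rw [← measurePreserving_toCircle.map_eq,
    Measure.map_map measurable_ofCircle measurePreserving_toCircle.measurable]
  have : ofCircle ∘ toCircle = id := funext ofCircle_toCircle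
  rw [this, Measure.map_id]

theorem toCircle_rot_iterate (α x : UnitIco) (i : ℕ) :
    toCircle ((rot α)^[i] x) = toCircle x + i • toCircle α := by
  induction i with
  | zero => simp
  | succ n ih =>
    rw [Function.iterate_succ_apply', succ_nsmul, ← add_assoc, ← ih]
    generalize (rot α)^[n] x = y
    have h1 : ((⌊(y : ℝ) + α⌋ : ℝ) : UnitAddCircle) = 0 :=
      AddCircle.coe_eq_zero_iff (1 : ℝ) |>.2 ⟨⌊(y : ℝ) + α⌋, by simp⟩
    change (((y : ℝ) + α - ⌊(y : ℝ) + α⌋ : ℝ) : UnitAddCircle) = _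
    rw [AddCircle.coe_sub, h1, sub_zero, AddCircle.coe_add]
    rfl

/-- Distinct affine forms `u + i v`, `u + j v` are independent and uniform on the circle. -/
theorem measurePreserving_add_nsmul_prod {i j : ℕ} (hij : i ≠ j) :
    MeasurePreserving
      (fun w : UnitAddCircle × UnitAddCircle => (w.1 + i • w.2, w.1 + j • w.2))
      (volume.prod volume) (volume.prod volume) := by
  let f : UnitAddCircle × UnitAddCircle →+ UnitAddCircle × UnitAddCircle :=
    AddMonoidHom.prod (AddMonoidHom.fst _ _ + i • AddMonoidHom.snd _ _)
      (AddMonoidHom.fst _ _ + j • AddMonoidHom.snd _ _)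
  -- A continuous surjective endomorphism of a compact group preserves normalized Haar measure.
  -- Surjectivity comes from divisibility of the circle: solve `(j - i) c = v - u`.
  refine AddMonoidHom.measurePreserving (f := f) (μ := volume.prod volume)
    (ν := volume.prod volume) ?_ ?_ rfl
  · change Continuous fun w : UnitAddCircle × UnitAddCircle => (w.1 + i • w.2, w.1 + j • w.2)
    fun_prop
  · rintro ⟨u, v⟩
    have hne : (j : ℤ) - i ≠ 0 := sub_ne_zero.2 (by exact_mod_cast hij.symm)
    have hdiv := DivisibleBy.div_cancel (A := UnitAddCircle) (v - u) hne
    set c := DivisibleBy.div (v - u) ((j : ℤ) - i)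
    rw [sub_zsmul, natCast_zsmul, natCast_zsmul] at hdiv
    refine ⟨(u - i • c, c), Prod.ext ?_ ?_⟩
    · change u - i • c + i • c = u
      abel
    · change u - i • c + j • c = v
      calc u - i • c + j • c = u + (j • c + -(i • c)) := by abel
        _ = v := by rw [hdiv, add_sub_cancel]

theorem measurePreserving_rot_iterate_prod {i j : ℕ} (hij : i ≠ j) :
    MeasurePreserving
      (fun w : UnitIco × UnitIco => ((rot w.2)^[i] w.1, (rot w.2)^[j] w.1))
      (lam.prod lam) (lam.prod lam) := by
  have h := (measurePreserving_ofCircle.prod measurePreserving_ofCircle).comp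
    ((measurePreserving_add_nsmul_prod hij).comp
      (measurePreserving_toCircle.prod measurePreserving_toCircle))
  convert h using 2 with w
  simp [← toCircle_rot_iterate, ofCircle_toCircle]

theorem measurePreserving_rot_iterate (i : ℕ) :
    MeasurePreserving (fun w : UnitIco × UnitIco => (rot w.2)^[i] w.1) (lam.prod lam) lam :=
  measurePreserving_fst.comp (measurePreserving_rot_iterate_prod i.lt_succ_self.ne)

/-- The metric does not wrap around, so a ball near an endpoint may lose one side; the side facing
the farther endpoint has room for length `min r (1/2)`. -/
theorem min_half_le_lam_ball (z : UnitIco) (r : ℝ) :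
    min r (1 / 2) ≤ lam.real (Metric.ball z r) := by
  rcases le_or_gt r 0 with hr | hr
  · exact (min_le_left _ _).trans (hr.trans measureReal_nonneg)
  set s := min r (1 / 2) with hs
  have hsr : s ≤ r := min_le_left _ _
  have hs2 : s ≤ 1 / 2 := min_le_right _ _
  have hs0 : 0 < s := lt_min hr (by norm_num)
  obtain ⟨a, ha0, ha1, haz⟩ : ∃ a : ℝ, 0 ≤ a ∧ a + s ≤ 1 ∧
      ∀ y ∈ Set.Ioo a (a + s), |y - z| < r := by
    have hz0 := z.2.1
    have hz1 := z.2.2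
    rcases le_total (z : ℝ) (1 / 2) with h | h
    · exact ⟨z, hz0, by linarith, fun y hy => abs_lt.2 ⟨by linarith [hy.1], by linarith [hy.2]⟩⟩
    · exact ⟨z - s, by linarith, by linarith,
        fun y hy => abs_lt.2 ⟨by linarith [hy.1], by linarith [hy.2]⟩⟩
  have hsub : Set.Ioo a (a + s) ⊆ Subtype.val '' Metric.ball z r := fun y hy =>
    ⟨⟨y, by linarith [hy.1], by linarith [hy.2]⟩, haz y hy, rfl⟩
  have hle : ENNReal.ofReal s ≤ lam (Metric.ball z r) := by
    rw [lam, (MeasurableEmbedding.subtype_coe measurableSet_Ico).comap_apply]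
    refine le_trans ?_ (measure_mono hsub)
    rw [Real.volume_Ioo, add_sub_cancel_left]
  exact (ENNReal.ofReal_le_iff_le_toReal (measure_ne_top _ _)).1 hle

/-- A summable `c` is eventually below `1/2`, and from then on the minimum is `b i`. -/
theorem not_summable_of_min_half_le {b c : ℕ → ℝ} (hbpos : ∀ i ≥ 1, 0 < b i)
    (hb : ¬ Summable b) (hc : ∀ i, min (b i) (1 / 2) ≤ c i) : ¬ Summable c := by
  intro h
  apply hb
  have h1 : ∀ᶠ i in atTop, c i < 1 / 2 := h.tendsto_atTop_zero.eventually_lt_const (by norm_num)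
  refine h.of_norm_bounded_eventually_nat ?_
  filter_upwards [h1, eventually_ge_atTop 1] with i hi hi1
  rw [Real.norm_of_nonneg (hbpos i hi1).le]
  exact ((min_le_iff.1 (hc i)).resolve_right hi.not_ge)

/-- Almost every orbit of almost every rotation hits shrinking balls around an arbitrary sequence of
centres infinitely often, if the radii have divergent sum. -/
theorem ae_frequently_rot_iterate_mem_ball (z : ℕ → UnitIco) {b : ℕ → ℝ}
    (hbpos : ∀ i ≥ 1, 0 < b i) (hb : ¬ Summable b) :
    ∀ᵐ w : UnitIco × UnitIco ∂(lam.prod lam),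
      ∃ᶠ i in atTop, z i ∈ Metric.ball ((rot w.2)^[i] w.1) (b i) := by
  have hpre : ∀ i, (lam.prod lam)
      ((fun w : UnitIco × UnitIco => (rot w.2)^[i] w.1) ⁻¹' Metric.ball (z i) (b i)) =
      lam (Metric.ball (z i) (b i)) := fun i =>
    (measurePreserving_rot_iterate i).measure_preimage measurableSet_ball.nullMeasurableSet
  have hmeas : ∀ i, MeasurableSet
      ((fun w : UnitIco × UnitIco => (rot w.2)^[i] w.1) ⁻¹' Metric.ball (z i) (b i)) := fun i =>
    (measurePreserving_rot_iterate i).measurable measurableSet_ball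
  have h := ae_frequently_mem_of_pairwise_indepSet (lam.prod lam) hmeas ?_ ?_
  · filter_upwards [h] with w hw
    refine hw.mono fun i hi => ?_
    rwa [Metric.mem_ball_comm]
  · intro i j hij
    rw [indepSet_iff_measure_inter_eq_mul (hmeas i) (hmeas j) (lam.prod lam), hpre, hpre, ← Measure.prod_prod,
      ← (measurePreserving_rot_iterate_prod hij).measure_preimage
        (measurableSet_ball.prod measurableSet_ball).nullMeasurableSet]
    rfl
  · refine not_summable_of_min_half_le hbpos hb fun i => ?_
    rw [measureReal_def, hpre]
    exact min_half_le_lam_ball _ _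

theorem exists_mem_Ico_of_mem_stdSimplex {d : ℕ} {p : Fin d → ℝ} (hp : p ∈ stdSimplex ℝ (Fin d))
    (x : UnitIco) :
    ∃ j, (x : ℝ) ∈ Set.Ico (∑ t with t < j, p t) ((∑ t with t < j, p t) + p j) := by
  by_contra! hx
  -- A point in no interval lies beyond every partial sum, including the total `1`.
  have hle : ∀ n ≤ d, ∑ t : Fin d with t.val < n, p t ≤ x := by
    intro n
    induction n with
    | zero => intro _; simpa using x.2.1
    | succ n ih =>
      intro hn
      have hsucc : (Finset.univ.filter fun t : Fin d => t.val < n + 1) =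
          insert ⟨n, hn⟩ (Finset.univ.filter fun t : Fin d => t.val < n) := by
        ext t
        simp only [Finset.mem_filter_univ, Finset.mem_insert, Fin.ext_iff]
        omega
      rw [hsucc, Finset.sum_insert (by simp), add_comm]
      by_contra! hlt
      exact hx ⟨n, hn⟩ ⟨ih (by omega), hlt⟩
  have h1 := hle d le_rfl
  simp only [Fin.is_lt, Finset.filter_true, hp.2] at h1
  exact absurd x.2.2 h1.not_gt

theorem IsIET.measurable {T : UnitIco → UnitIco} (hT : IsIET T) : Measurable T := by
  obtain ⟨d, p, π, hp, hT⟩ := hT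
  set I : Fin d → Set UnitIco := fun j =>
    Subtype.val ⁻¹' Set.Ico (∑ t with t < j, p t) ((∑ t with t < j, p t) + p j) with hI
  set f : Fin d → UnitIco → ℝ := fun j x =>
    (x : ℝ) - (∑ t with t < j, p t) + ∑ t with π t < π j, p t with hf
  have hfm : ∀ j, Measurable (f j) := fun j => by fun_prop
  have hval : Measurable fun x => (T x : ℝ) := by
    intro s hs
    have hpre : (fun x => (T x : ℝ)) ⁻¹' s = ⋃ j, I j ∩ f j ⁻¹' s := by
      ext x
      simp only [Set.mem_preimage, Set.mem_iUnion, Set.mem_inter_iff]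
      refine ⟨fun hx => ?_, fun ⟨j, hj, hx⟩ => by rwa [hT j x hj]⟩
      obtain ⟨j, hj⟩ := exists_mem_Ico_of_mem_stdSimplex hp x
      exact ⟨j, hj, by rwa [hT j x hj] at hx⟩
    rw [hpre]
    exact MeasurableSet.iUnion fun j =>
      (measurable_subtype_coe measurableSet_Ico).inter (hfm j hs)
  exact hval.subtype_mk

theorem corollary2p5 (T : UnitIco → UnitIco) (hT : IsIET T)
    (hTerg : PreErgodic T lam)
    (b : ℕ → ℝ) (hbpos : ∀ i ≥ 1, 0 < b i) (hbdec : AntitoneOn b (Set.Ici 1))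
    (hbsum : ¬ Summable b) :
    ∀ᵐ xα : UnitIco × UnitIco ∂(lam.prod lam),
      lam (targetSet T b xα.1 xα.2) = 1 := by
  have hTm := hT.measurable
  have hmem : ∀ w : UnitIco × UnitIco, ∀ y, y ∈ targetSet T b w.1 w.2 ↔
      ∃ᶠ i in atTop, T^[i] y ∈ Metric.ball ((rot w.2)^[i] w.1) (b i) := by
    intro w y
    simp only [targetSet, Set.mem_iInter, Set.mem_iUnion, Set.mem_preimage, exists_prop,
      frequently_atTop]
    refine ⟨fun h n => ?_, fun h n _ => h n⟩
    obtain ⟨i, hi, hy⟩ := h (max n 1) (le_max_right _ _)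
    exact ⟨i, (le_max_left _ _).trans hi, hy⟩
  -- Joint measurability is what allows the two almost-everywhere quantifiers to be exchanged.
  have hmeas : MeasurableSet {v : UnitIco × (UnitIco × UnitIco) |
      ∃ᶠ i in atTop, T^[i] v.1 ∈ Metric.ball ((rot v.2.2)^[i] v.2.1) (b i)} := by
    simp only [frequently_atTop, Set.ofPred_forall, Set.ofPred_exists, Set.ofPred_and]
    refine MeasurableSet.iInter fun n => MeasurableSet.iUnion fun i =>
      (MeasurableSet.const _).inter ?_
    exact measurableSet_lt (((hTm.iterate i).comp measurable_fst).dist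
      ((measurePreserving_rot_iterate i).measurable.comp measurable_snd)) measurable_const
  have hae : ∀ᵐ y ∂lam, ∀ᵐ w ∂(lam.prod lam),
      ∃ᶠ i in atTop, T^[i] y ∈ Metric.ball ((rot w.2)^[i] w.1) (b i) :=
    ae_of_all _ fun y => ae_frequently_rot_iterate_mem_ball (fun i => T^[i] y) hbpos hbsum
  rw [Measure.ae_ae_comm hmeas] at hae
  filter_upwards [hae] with w hw
  have hset : targetSet T b w.1 w.2 = {y | ∃ᶠ i in atTop,
      T^[i] y ∈ Metric.ball ((rot w.2)^[i] w.1) (b i)} := Set.ext (hmem w)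
  rw [hset]
  exact (mem_ae_iff_prob_eq_one (measurable_prodMk_right hmeas)).1 hw
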